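/- Graphs are finite multigraphs without loops. For such a graph $G$, let $\mathrm{Div}(G)$ be the free abelian group on the vertex set $V(G)$, let $\mathrm{Pic}(G)$ be its quotient by the subgroup generated by the divisors $\sum_{vw\in E(G)}(v-w)$, $v\in V(G)$ (for each $v$, the sum is over all edges at $v$, counted with multiplicity), and let the Jacobian $\mathrm{Jac}(G)$ be the kernel of the degree homomorphism $\mathrm{Pic}(G)\to\mathbb Z$. Let $R$ be Tutte's rotor of order $3$. It is the simple graph with ten vertices $a_0,a_1,a_2,\,p_0,p_1,p_2,\,q_0,q_1,q_2,\,o$ and the fifteen edges $a_ip_i,\ p_ia_{i+1},\ q_ia_i,\ q_ip_i,\ oq_i$, where $i=0,1,2$ and indices are read modulo $3$. The vertices $a_0,a_1,a_2$ are also called $a,b,c$, and the rotation $f$, which raises every index by one and fixes $o$, is an automorphism of order $3$ with $f(a)=b$, $f(b)=c$, $f(c)=a$. For a graph $S$ and a map $g:\{a,b,c\}\to V(S)$, not necessarily injective, let $R\cup_g S$ be the supergraph obtained from the disjoint union of $R$ and $S$ by identifying $a,b,c$ with $g(a),g(b),g(c)$ respectively; all edges of $R$ and $S$ are kept, and no edges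 are added. **Theorem.** Let $S$ be a connected planar graph, let $g:\{a,b,c\}\to V(S)$ be any map, and let $\sigma$ be any permutation of $\{a,b,c\}$. Put $G=R\cup_g S$ and $H=R\cup_{g\circ\sigma}S$. If $G$ and $H$ are planar, then $$\mathrm{Jac}(G)\cong\mathrm{Jac}(H).$$ (The two graphs of Tutte's rotor construction are $G$ and the graph $H$ in which $R$ has been reflected before gluing, that is, $\sigma$ is a transposition, for example $\sigma$ fixes $a$ and exchanges $b$ and $c$.) -/

import Mathlib

open scoped Graph

namespace TutteRotor

section General

variable {α β α' β' : Type*}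

/-- A multigraph is connected if it has a vertex and any two vertices are joined by a walk. -/
def IsConnected (G : Graph α β) : Prop :=
  V(G).Nonempty ∧ ∀ u ∈ V(G), ∀ v ∈ V(G), Relation.ReflTransGen G.Adj u v

/-- A multigraph is planar if it can be drawn in the Euclidean plane: vertices are distinct points,
every edge is an arc joining the points of its two ends, no interior point of an arc is a
vertex, and arcs neither cross themselves nor meet each other in interior points. -/
def IsPlanar (G : Graph α β) : Prop :=
  ∃ (p : V(G) → EuclideanSpace ℝ (Fin 2))
    (γ : E(G) → C(unitInterval, EuclideanSpace ℝ (Fin 2))),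
    Function.Injective p ∧
    (∀ e : E(G), ∃ u v : V(G), G.IsLink e u v ∧ γ e 0 = p u ∧ γ e 1 = p v) ∧
    (∀ e : E(G), ∀ s ∈ Set.Ioo (0 : unitInterval) 1, ∀ v : V(G), γ e s ≠ p v) ∧
    (∀ e e' : E(G), ∀ s ∈ Set.Ioo (0 : unitInterval) 1, ∀ t ∈ Set.Ioo (0 : unitInterval) 1,
      γ e s = γ e' t → e = e' ∧ s = t)

/-- The group of divisors: the free abelian group on the vertices. -/
abbrev Div (G : Graph α β) : Type _ := V(G) →₀ ℤ

/-- The degree of a divisor, the sum of its coefficients. -/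
noncomputable def deg (G : Graph α β) : Div G →+ ℤ := Finsupp.liftAddHom fun _ => AddMonoidHom.id ℤ

/-- The number of edges joining `u` and `v` in a finite multigraph. -/
noncomputable def mult (G : Graph α β) (u v : α) : ℕ := {e | G.IsLink e u v}.ncard

/-- The divisor `∑ (v - w)`, summed over all edges `vw` at `v`, of a finite multigraph: a borrowing
move at `v` adds it, a lending move at `v` subtracts it. -/
noncomputable def move (G : Graph α β) (v : V(G)) : Div G :=
  ∑ᶠ w : V(G), mult G v w • (Finsupp.single v (1 : ℤ) - Finsupp.single w 1)

/-- The divisors reachable from `0` by finitely many lending and borrowing moves. -/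
noncomputable def principal (G : Graph α β) : AddSubgroup (Div G) :=
  AddSubgroup.closure (Set.range (move G))

theorem deg_move (G : Graph α β) (v : V(G)) : deg G (move G v) = 0 := by
  have h : move G v ∈ (deg G).ker := by
    refine finsum_induction (fun D => D ∈ (deg G).ker) ?_ ?_ ?_
    · exact zero_mem _
    · exact fun _ _ => add_mem
    · intro w
      refine nsmul_mem ?_ _
      rw [AddMonoidHom.mem_ker, map_sub]
      simp [deg]
  exact h

theorem principal_le_ker_deg (G : Graph α β) : principal G ≤ (deg G).ker := by
  rw [principal, AddSubgroup.closure_le]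
  rintro _ ⟨v, rfl⟩
  exact deg_move G v

/-- The Picard group: divisors modulo lending and borrowing moves. -/
abbrev Pic (G : Graph α β) : Type _ := Div G ⧸ principal G

/-- The degree homomorphism on the Picard group. -/
noncomputable def picDeg (G : Graph α β) : Pic G →+ ℤ :=
  QuotientAddGroup.lift (principal G) (deg G) (principal_le_ker_deg G)

/-- The Jacobian of a finite multigraph: the kernel of the degree homomorphism on the
Picard group. -/
abbrev Jac (G : Graph α β) : Type _ := (picDeg G).ker

/-- The disjoint union of two multigraphs. -/
def disjUnion (G : Graph α β) (H : Graph α' β') : Graph (α ⊕ α') (β ⊕ β') where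
  vertexSet := Sum.inl '' V(G) ∪ Sum.inr '' V(H)
  IsLink
    | .inl e, .inl x, .inl y => G.IsLink e x y
    | .inr e, .inr x, .inr y => H.IsLink e x y
    | _, _, _ => False
  isLink_symm := by
    intro e _
    constructor
    intro x y h
    rcases e with e | e <;> rcases x with x | x <;> rcases y with y | y <;> simp_all
    · exact h.symm
    · exact h.symm
  eq_or_eq_of_isLink_of_isLink := by
    intro e x y v w h h'
    rcases e with e | e <;> rcases x with x | x <;> rcases y with y | y <;>
      rcases v with v | v <;> rcases w with w | w <;> simp_all
    · exact h.left_eq_or_eq h'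
    · exact h.left_eq_or_eq h'
  left_mem_of_isLink := by
    intro e x y h
    rcases e with e | e <;> rcases x with x | x <;> rcases y with y | y <;> simp_all
    · exact h.left_mem
    · exact h.left_mem

end General

/-- The ten vertices of Tutte's rotor of order three: `corner 0`, `corner 1`, `corner 2` are the
vertices `a`, `b`, `c`. -/
inductive RotorVertex : Type
  | corner (i : Fin 3)
  | side (i : Fin 3)
  | inner (i : Fin 3)
  | center
  deriving DecidableEq, Fintype

/-- The fifteen edges of Tutte's rotor of order three. -/
inductive RotorEdge : Type
  | left (i : Fin 3)
  | right (i : Fin 3)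
  | toCorner (i : Fin 3)
  | toSide (i : Fin 3)
  | spoke (i : Fin 3)
  deriving DecidableEq, Fintype

/-- The two ends of an edge of the rotor; indices are read modulo three. The vertex `side i` is
the middle of the side of the triangle between `corner i` and `corner (i + 1)`. -/
def rotorEnds : RotorEdge → Sym2 RotorVertex
  | .left i => s(.corner i, .side i)
  | .right i => s(.side i, .corner (i + 1))
  | .toCorner i => s(.inner i, .corner i)
  | .toSide i => s(.inner i, .side i)
  | .spoke i => s(.center, .inner i)

/-- Tutte's rotor of order three. -/
def rotor : Graph RotorVertex RotorEdge where
  vertexSet := Set.univ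
  IsLink e x y := rotorEnds e = s(x, y)
  isLink_symm := by
    intro e _
    exact ⟨fun x y h => h.trans Sym2.eq_swap⟩
  eq_or_eq_of_isLink_of_isLink := by
    intro e x y v w h h'
    have := h.symm.trans h'
    rw [Sym2.eq_iff] at this
    tauto
  left_mem_of_isLink := by simp

variable {α β : Type*}

/-- The identification of the vertex `corner i` of the rotor with the vertex `g i`. -/
def identify (g : Fin 3 → α) : RotorVertex ⊕ α → RotorVertex ⊕ α
  | .inl (.corner i) => .inr (g i)
  | x => x

/-- The supergraph: the rotor and `S` are glued by identifying `corner i` with `g i` for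
`i = 0, 1, 2`; all edges are kept, and no edges are added. -/
def supergraph (S : Graph α β) (g : Fin 3 → V(S)) : Graph (RotorVertex ⊕ α) (RotorEdge ⊕ β) :=
  (disjUnion rotor S).map (identify fun i => (g i : α))

end TutteRotor

/-!
For Tutte's rotor `R` of order three the Jacobians of the two graphs are isomorphic for an algebraic
reason which needs no planarity, and which holds for every finite `S`.

Write `a i`, `p i`, `q i`, `o` for the classes in `Pic (supergraph S g)` of the vertices `corner i`,
`side i`, `inner i`, `center`. The moves at the seven vertices of the rotor other than its corners
give the relations `3 p i = a i + a (i + 1) + q i`, `3 q i = a i + p i + o` and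
`3 o = q 0 + q 1 + q 2` (`IsRotorHarmonic`). With `A = a 0 + a 1 + a 2`, adding them up shows that
`15 o = 5 A` (`IsRotorHarmonic.torsion`). The graph `S` sees the rotor only through its corners and
through the contributions `3 a i - p i - p (i - 1) - q i` of the rotor to the moves there.

No automorphism of `R` reflects the corners, but the relations have such a symmetry: for every `k`,
the substitution
`a i ↦ a (k - i)`, `p i ↦ A - o - q (k + 1 - i)`, `q i ↦ 2 A - 4 o - p (k + 1 - i)`,
`o ↦ 4 A - 11 o`
preserves the relations (`IsRotorHarmonic.reflect`), carries the contribution at the corner `i` to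
the one at the corner `k - i` (`IsRotorHarmonic.reflect_corner`), preserves degrees, and is an
involution, since applying it twice changes each generator by a multiple of `15 o - 5 A`. Hence it
induces mutually inverse homomorphisms between the Picard groups of the two supergraphs whose
gluing maps differ by the transposition `i ↦ k - i` (`nonempty_jac_equiv_reflection`). Every
permutation of the corners is a product of transpositions.

Homomorphisms out of the Picard group of a finite graph are constructed from functions on the
vertices with vanishing Laplacian (`exists_pic_lift`); the Laplacian of a supergraph is computed
edge by edge (`lap_eq_sum`), which handles gluing maps that are not injective.
-/

namespace TutteRotor

/-! ### The Laplacian of a function on the vertices -/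

section Laplacian

variable {α β A : Type*} [AddCommGroup A]

/-- The Laplacian at `v` of a function `z` with values in an abelian group: the sum of `z v - z w`
over all edges `vw`. The function is defined on the whole ambient type, but only its values on the
vertices of `G` matter when `v` is a vertex. -/
noncomputable def lap (G : Graph α β) (z : α → A) (v : α) : A :=
  ∑ᶠ w : V(G), mult G v w • (z v - z w)

/-- The Laplacian as a sum over the edges, each with a chosen orientation `s e`, `t e`. A loop
contributes zero on both sides. -/
theorem lap_eq_sum {G : Graph α β} (hV : V(G).Finite) (B : Finset β) (hB : ∀ e, e ∈ B ↔ e ∈ E(G))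
    {s t : β → α} (hst : ∀ e ∈ B, G.IsLink e (s e) (t e)) [DecidableEq α] (z : α → A) (v : α) :
    lap G z v = ∑ e ∈ B, ((if s e = v then z (s e) - z (t e) else 0) +
      (if t e = v then z (t e) - z (s e) else 0)) := by
  classical
  have hmult (w : α) : mult G v w • (z v - z w) =
      ∑ e ∈ B, if G.IsLink e v w then z v - z w else 0 := by
    have : {e | G.IsLink e v w} = ({e ∈ B | G.IsLink e v w} : Finset β) := by
      ext e
      simpa [hB] using fun h : G.IsLink e v w => h.edge_mem
    rw [mult, this, Set.ncard_coe_finset, ← Finset.sum_filter, Finset.sum_const]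
  have hfin : Fintype V(G) := hV.fintype
  rw [lap, finsum_eq_sum_of_fintype]
  simp_rw [hmult]
  rw [Finset.sum_comm]
  refine Finset.sum_congr rfl fun e he => ?_
  have hl := hst e he
  have hlink (w : α) : G.IsLink e v w ↔ (s e = v ∧ t e = w) ∨ (t e = v ∧ s e = w) := by
    constructor
    · intro h
      have := hl.eq_and_eq_or_eq_and_eq h
      tauto
    · rintro (⟨rfl, rfl⟩ | ⟨rfl, rfl⟩)
      exacts [hl, hl.symm]
  -- only the other end `u` of the edge `e` contributes; a loop has `u = v`
  have hone (u : α) (hu : u ∈ V(G)) (h : ∀ w, G.IsLink e v w → w = v ∨ w = u)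
      (hvu : G.IsLink e v u) :
      ∑ w : V(G), (if G.IsLink e v w then z v - z w else 0) = z v - z u := by
    rw [Finset.sum_eq_single ⟨u, hu⟩]
    · simp [hvu]
    · rintro ⟨w, hw⟩ - hne
      split_ifs with hw'
      · rcases h w hw' with rfl | rfl
        · simp
        · exact absurd rfl hne
      · rfl
    · simp
  by_cases h1 : s e = v
  · rw [hone (t e) hl.right_mem (fun w hw => ?_) ((hlink _).2 (.inl ⟨h1, rfl⟩))]
    · by_cases h2 : t e = v <;> simp [h1, h2]
    · rcases (hlink w).1 hw with h | h
      · exact .inr h.2.symm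
      · exact .inl (h.2.symm.trans h1)
  · by_cases h2 : t e = v
    · rw [hone (s e) hl.left_mem (fun w hw => ?_) ((hlink _).2 (.inr ⟨h2, rfl⟩))]
      · simp [h1, h2]
      · rcases (hlink w).1 hw with h | h
        · exact absurd h.1 h1
        · exact .inr h.2.symm
    · simp [hlink, h1, h2]

end Laplacian

/-! ### Homomorphisms between Picard groups -/

section Picard

variable {α β : Type*} {A : Type*} [AddCommGroup A] {G : Graph α β}

open Classical in
/-- The class in the Picard group of a vertex, with the value `0` outside of the vertex set. -/
noncomputable def cls (G : Graph α β) (v : α) : Pic G :=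
  if h : v ∈ V(G) then QuotientAddGroup.mk (Finsupp.single ⟨v, h⟩ 1) else 0

theorem map_move (hV : V(G).Finite) (F : Div G →+ A) (z : α → A)
    (hF : ∀ v : V(G), F (Finsupp.single v 1) = z v) (v : V(G)) :
    F (move G v) = lap G z v := by
  have : Fintype V(G) := hV.fintype
  simp [move, lap, finsum_eq_sum_of_fintype, hF]

theorem lap_cls (hV : V(G).Finite) {v : α} (hv : v ∈ V(G)) : lap G (cls G) v = 0 := by
  rw [← map_move hV (QuotientAddGroup.mk' (principal G)) (cls G) (fun w => ?_) ⟨v, hv⟩]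
  · exact (QuotientAddGroup.eq_zero_iff _).2 (AddSubgroup.subset_closure ⟨_, rfl⟩)
  · simp [cls]

/-- The universal property of the Picard group: a function on the vertices whose Laplacian vanishes
extends to a homomorphism. -/
theorem exists_pic_lift (hV : V(G).Finite) (z : α → A) (hz : ∀ v ∈ V(G), lap G z v = 0) :
    ∃ F : Pic G →+ A, ∀ v ∈ V(G), F (cls G v) = z v := by
  set f : Div G →+ A := Finsupp.liftAddHom fun v => (zmultiplesHom A) (z v) with hf
  have hf1 (v : V(G)) : f (Finsupp.single v 1) = z v := by simp [hf]
  have hle : principal G ≤ f.ker := by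
    rw [principal, AddSubgroup.closure_le]
    rintro _ ⟨v, rfl⟩
    exact (map_move hV f z hf1 v).trans (hz v v.2)
  refine ⟨QuotientAddGroup.lift _ f hle, fun v hv => ?_⟩
  rw [cls, dif_pos hv]
  exact hf1 _

theorem pic_hom_ext {F F' : Pic G →+ A} (h : ∀ v ∈ V(G), F (cls G v) = F' (cls G v)) : F = F' := by
  refine QuotientAddGroup.addMonoidHom_ext _ (Finsupp.addHom_ext' fun v => ?_)
  ext
  simpa [cls] using h v v.2

theorem picDeg_cls {v : α} (hv : v ∈ V(G)) : picDeg G (cls G v) = 1 := by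
  rw [cls, dif_pos hv]
  simp [picDeg, deg]

theorem nonempty_jac_equiv {α' β' : Type*} {H : Graph α' β'} (F : Pic G →+ Pic H)
    (F' : Pic H →+ Pic G) (hd : ∀ v ∈ V(G), picDeg H (F (cls G v)) = 1)
    (h : ∀ v ∈ V(G), F' (F (cls G v)) = cls G v) (h' : ∀ v ∈ V(H), F (F' (cls H v)) = cls H v) :
    Nonempty (Jac G ≃+ Jac H) := by
  have hF : F'.comp F = AddMonoidHom.id _ := pic_hom_ext (by simpa using h)
  have hF' : F.comp F' = AddMonoidHom.id _ := pic_hom_ext (by simpa using h')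
  have hdeg : (picDeg H).comp F = picDeg G :=
    pic_hom_ext fun v hv => by rw [AddMonoidHom.comp_apply, hd v hv, picDeg_cls hv]
  have hdeg' (x : Pic H) : picDeg G (F' x) = picDeg H x := by
    rw [← hdeg, AddMonoidHom.comp_apply]
    exact congrArg _ (DFunLike.congr_fun hF' x)
  exact ⟨{
    toFun x := ⟨F x.1, (DFunLike.congr_fun hdeg x.1).trans x.2⟩
    invFun x := ⟨F' x.1, (hdeg' x.1).trans x.2⟩
    left_inv x := Subtype.ext (DFunLike.congr_fun hF x.1)
    right_inv x := Subtype.ext (DFunLike.congr_fun hF' x.1)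
    map_add' _ _ := Subtype.ext (map_add F _ _) }⟩

end Picard

/-! ### The Laplacian of a supergraph -/

section Supergraph

variable {α β : Type*} {A : Type*} [AddCommGroup A] {S : Graph α β} {g : Fin 3 → V(S)}

theorem mem_supergraph_inr {s : α} : .inr s ∈ V(supergraph S g) ↔ s ∈ V(S) := by
  constructor
  · rintro ⟨x, hx, h⟩
    rcases hx with ⟨r, -, rfl⟩ | ⟨s', hs', rfl⟩
    · rcases r with i | i | i | _ <;> simp [identify] at h
      exact h ▸ (g i).2
    · simp only [identify, Sum.inr.injEq] at h
      exact h ▸ hs'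
  · exact fun hs => ⟨.inr s, .inr ⟨s, hs, rfl⟩, rfl⟩

theorem mem_supergraph_inl {r : RotorVertex} :
    .inl r ∈ V(supergraph S g) ↔ ∀ i, r ≠ .corner i := by
  constructor
  · rintro ⟨x, hx, h⟩ i rfl
    rcases hx with ⟨r, -, rfl⟩ | ⟨s', hs', rfl⟩
    · rcases r with i | i | i | _ <;> simp [identify] at h
    · simp [identify] at h
  · intro h
    refine ⟨.inl r, .inl ⟨r, trivial, rfl⟩, ?_⟩
    rcases r with i | i | i | _
    exacts [absurd rfl (h i), rfl, rfl, rfl]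

theorem finite_supergraph (hV : V(S).Finite) : V(supergraph S g).Finite :=
  (((Set.toFinite _).image _).union (hV.image _)).image _

/-- The first end of an edge of the rotor, in the order of `rotorEnds`. -/
def rotorSource : RotorEdge → RotorVertex
  | .left i => .corner i
  | .right i => .side i
  | .toCorner i => .inner i
  | .toSide i => .inner i
  | .spoke _ => .center

/-- The second end of an edge of the rotor, in the order of `rotorEnds`. -/
def rotorTarget : RotorEdge → RotorVertex
  | .left i => .side i
  | .right i => .corner (i + 1)
  | .toCorner i => .corner i
  | .toSide i => .side i
  | .spoke i => .inner i

theorem sum_rotorEdge (f : RotorEdge → A) : ∑ e, f e = ∑ i : Fin 3,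
    (f (.left i) + f (.right i) + f (.toCorner i) + f (.toSide i) + f (.spoke i)) := by
  have huniv : (Finset.univ : Finset RotorEdge) = Finset.univ.image RotorEdge.left ∪
      Finset.univ.image RotorEdge.right ∪ Finset.univ.image RotorEdge.toCorner ∪
      Finset.univ.image RotorEdge.toSide ∪ Finset.univ.image RotorEdge.spoke := by decide
  have himage {φ : Fin 3 → RotorEdge} (hφ : ∀ i j, φ i = φ j → i = j) :
      ∑ e ∈ Finset.univ.image φ, f e = ∑ i, f (φ i) :=
    Finset.sum_image fun i _ j _ h => hφ i j h
  rw [huniv, Finset.sum_union (by decide), Finset.sum_union (by decide),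
    Finset.sum_union (by decide), Finset.sum_union (by decide), himage (by decide),
    himage (by decide), himage (by decide), himage (by decide), himage (by decide)]
  simp only [Finset.sum_add_distrib]

/-- The function on the vertices of a supergraph with values `p i`, `q i`, `o` at the sides, the
inner vertices and the center of the rotor, and `y` on `S`. The value at the corners of the rotor is
arbitrary: they are identified with vertices of `S`. -/
def glue (p q : Fin 3 → A) (o : A) (y : α → A) : RotorVertex ⊕ α → A
  | .inl (.corner _) => 0
  | .inl (.side i) => p i
  | .inl (.inner i) => q i
  | .inl .center => o
  | .inr s => y s

open Classical in
/-- The edges of the rotor and the edges of `S` contribute separately to the Laplacian. -/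
theorem lap_supergraph (hV : V(S).Finite) (hE : E(S).Finite) (z : RotorVertex ⊕ α → A)
    (v : RotorVertex ⊕ α) :
    lap (supergraph S g) z v =
      (∑ e, ((if identify (fun i => (g i : α)) (.inl (rotorSource e)) = v then
          z (identify (fun i => (g i : α)) (.inl (rotorSource e))) -
            z (identify (fun i => (g i : α)) (.inl (rotorTarget e))) else 0) +
        (if identify (fun i => (g i : α)) (.inl (rotorTarget e)) = v then
          z (identify (fun i => (g i : α)) (.inl (rotorTarget e))) -
            z (identify (fun i => (g i : α)) (.inl (rotorSource e))) else 0))) +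
      Sum.elim (fun _ => 0) (lap S (z ∘ .inr)) v := by
  set f : RotorVertex ⊕ α → RotorVertex ⊕ α := identify fun i => (g i : α)
  have hends (e : β) : ∃ st : α × α, e ∈ E(S) → S.IsLink e st.1 st.2 := by
    by_cases he : e ∈ E(S)
    · obtain ⟨x, y, h⟩ := S.exists_isLink_of_mem_edgeSet he
      exact ⟨(x, y), fun _ => h⟩
    · exact ⟨(g 0, g 0), fun h => absurd h he⟩
  choose st hst using hends
  have hS := lap_eq_sum hV hE.toFinset (fun _ => hE.mem_toFinset) (s := fun e => (st e).1)
    (t := fun e => (st e).2) (fun e he => hst e (hE.mem_toFinset.1 he)) (z ∘ .inr)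
  have hlinkR (e : RotorEdge) : (supergraph S g).IsLink (.inl e) (f (.inl (rotorSource e)))
      (f (.inl (rotorTarget e))) := by
    refine Graph.IsLink.map f (u := .inl (rotorSource e)) (v := .inl (rotorTarget e)) ?_
    change rotorEnds e = s(rotorSource e, rotorTarget e)
    cases e <;> rfl
  have hlinkS (e : β) (he : e ∈ E(S)) : (supergraph S g).IsLink (.inr e) (f (.inr (st e).1))
      (f (.inr (st e).2)) :=
    Graph.IsLink.map f (G := disjUnion rotor S) (u := .inr (st e).1) (v := .inr (st e).2) (hst e he)
  have hmem (e : RotorEdge ⊕ β) : e ∈ Finset.univ.disjSum hE.toFinset ↔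
      e ∈ E(supergraph S g) := by
    rcases e with e | e
    · simpa using (hlinkR e).edge_mem
    · simp only [Finset.inr_mem_disjSum, Set.Finite.mem_toFinset]
      refine ⟨fun he => (hlinkS e he).edge_mem, fun he => ?_⟩
      obtain ⟨_, _, x, y, h, -, -⟩ := Graph.exists_isLink_of_mem_edgeSet he
      rcases x with x | x <;> rcases y with y | y
      · exact h.elim
      · exact h.elim
      · exact h.elim
      · exact Graph.IsLink.edge_mem (G := S) h
  rw [lap_eq_sum (finite_supergraph hV) _ hmem
    (s := Sum.elim (fun e => f (.inl (rotorSource e))) (fun e => f (.inr (st e).1)))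
    (t := Sum.elim (fun e => f (.inl (rotorTarget e))) (fun e => f (.inr (st e).2))),
    Finset.sum_disjSum]
  · congr 1
    rcases v with r | s
    · simp [f, identify]
    · simp only [Sum.elim_inr, hS]
      simp [f, identify]
  · rintro (e | e) he
    · exact hlinkR e
    · exact hlinkS e (by simpa using he)

theorem lap_side (hV : V(S).Finite) (hE : E(S).Finite) (z : RotorVertex ⊕ α → A) (i : Fin 3) :
    lap (supergraph S g) z (.inl (.side i)) = 3 • z (.inl (.side i)) -
      z (.inr (g i)) - z (.inr (g (i + 1))) - z (.inl (.inner i)) := by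
  rw [lap_supergraph hV hE, sum_rotorEdge]
  simp only [identify, rotorSource, rotorTarget]
  simp [Finset.sum_add_distrib]
  abel

theorem lap_inner (hV : V(S).Finite) (hE : E(S).Finite) (z : RotorVertex ⊕ α → A) (i : Fin 3) :
    lap (supergraph S g) z (.inl (.inner i)) = 3 • z (.inl (.inner i)) -
      z (.inr (g i)) - z (.inl (.side i)) - z (.inl .center) := by
  rw [lap_supergraph hV hE, sum_rotorEdge]
  simp only [identify, rotorSource, rotorTarget]
  simp [Finset.sum_add_distrib]
  abel

theorem lap_center (hV : V(S).Finite) (hE : E(S).Finite) (z : RotorVertex ⊕ α → A) :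
    lap (supergraph S g) z (.inl .center) = 3 • z (.inl .center) -
      z (.inl (.inner 0)) - z (.inl (.inner 1)) - z (.inl (.inner 2)) := by
  rw [lap_supergraph hV hE, sum_rotorEdge]
  simp only [identify, rotorSource, rotorTarget]
  simp [Fin.sum_univ_three]
  abel

open Classical in
/-- At a vertex of `S`, the rotor contributes once for every corner which is glued there. -/
theorem lap_inr (hV : V(S).Finite) (hE : E(S).Finite) (z : RotorVertex ⊕ α → A) (s : α) :
    lap (supergraph S g) z (.inr s) = lap S (z ∘ .inr) s + ∑ i : Fin 3, if (g i : α) = s then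
      3 • z (.inr (g i)) - z (.inl (.side i)) - z (.inl (.side (i - 1))) - z (.inl (.inner i))
      else 0 := by
  rw [lap_supergraph hV hE, sum_rotorEdge, add_comm]
  simp only [identify, rotorSource, rotorTarget]
  simp only [Sum.elim_inr, Sum.inr.injEq, reduceCtorEq, if_false, add_zero, zero_add]
  congr 1
  have h1 : (1 : Fin 3) + 1 = 2 := rfl
  have h2 : (2 : Fin 3) + 1 = 0 := rfl
  have h3 : (0 : Fin 3) - 1 = 2 := rfl
  have h4 : (2 : Fin 3) - 1 = 1 := rfl
  simp only [Fin.sum_univ_three, h1, h2, h3, h4, zero_add, sub_self]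
  -- gluing maps need not be injective, so all combinations of `g i = s` occur
  split_ifs <;> abel

end Supergraph

/-! ### The reflection of the rotor -/

section Reflection

/-- The Laplacian vanishes at the seven vertices of the rotor which are not corners, for the
function with values `a i`, `p i`, `q i`, `o` at `corner i`, `side i`, `inner i`, `center`. -/
structure IsRotorHarmonic {A : Type*} [AddCommGroup A] (a p q : Fin 3 → A) (o : A) : Prop where
  side (i : Fin 3) : 3 • p i - a i - a (i + 1) - q i = 0
  inner (i : Fin 3) : 3 • q i - a i - p i - o = 0
  center : 3 • o - q 0 - q 1 - q 2 = 0

namespace IsRotorHarmonic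

variable {A : Type*} [AddCommGroup A] {a p q : Fin 3 → A} {o : A}

theorem sum_eq_add_add (f : Fin 3 → A) (m : Fin 3) : ∑ j, f j = f m + f (m + 1) + f (m - 1) := by
  rw [Fin.sum_univ_three]
  fin_cases m
  · rfl
  · change _ = f 1 + f 2 + f 0
    abel
  · change _ = f 2 + f 0 + f 1
    abel

theorem three_nsmul_center (h : IsRotorHarmonic a p q o) : 3 • o = ∑ j, q j := by
  rw [Fin.sum_univ_three]
  linear_combination (norm := module) h.center

theorem three_nsmul_sum_inner (h : IsRotorHarmonic a p q o) :
    3 • ∑ j, q j = ∑ j, a j + ∑ j, p j + 3 • o := by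
  simp only [Fin.sum_univ_three]
  linear_combination (norm := module) h.inner 0 + h.inner 1 + h.inner 2

theorem three_nsmul_sum_side (h : IsRotorHarmonic a p q o) :
    3 • ∑ j, p j = 2 • ∑ j, a j + ∑ j, q j := by
  have hside := Finset.sum_eq_zero (s := Finset.univ) fun i _ => h.side i
  have hrot : ∑ i, a (i + 1) = ∑ i, a i := Equiv.sum_comp (Equiv.addRight 1) a
  simp only [Finset.sum_sub_distrib, ← Finset.smul_sum, hrot] at hside
  linear_combination (norm := module) hside

/-- The difference `3 o - (a 0 + a 1 + a 2)` is killed by `5`. This is the one consequence of the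
relations that makes the reflection well defined and an involution. -/
theorem torsion (h : IsRotorHarmonic a p q o) : 15 • o = 5 • ∑ j, a j := by
  linear_combination (norm := module) (8 : ℤ) • h.three_nsmul_center +
    (3 : ℤ) • h.three_nsmul_sum_inner + h.three_nsmul_sum_side

/-- The symmetry of the rotor relations which reflects the corners. -/
theorem reflect (h : IsRotorHarmonic a p q o) (k : Fin 3) :
    IsRotorHarmonic (fun i => a (k - i)) (fun i => ∑ j, a j - o - q (k + 1 - i))
      (fun i => 2 • ∑ j, a j - 4 • o - p (k + 1 - i)) (4 • ∑ j, a j - 11 • o) where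
  side i := by
    have h1 : k - i = k + 1 - i - 1 := by abel
    have h2 : k - (i + 1) = k + 1 - i + 1 := by decide +revert
    rw [h1, h2, sum_eq_add_add a (k + 1 - i)]
    linear_combination (norm := module) - h.inner (k + 1 - i)
  inner i := by
    have h1 : k - i = k + 1 - i - 1 := by abel
    rw [h1, sum_eq_add_add a (k + 1 - i)]
    linear_combination (norm := module) - h.side (k + 1 - i)
  center := by
    have h2 : k + 1 - 2 = k + 1 + 1 := by decide +revert
    have hP := sum_eq_add_add p (k + 1)
    simp only [sub_zero, h2]
    linear_combination (norm := module) -hP - h.three_nsmul_sum_inner -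
      (3 : ℤ) • h.three_nsmul_center - h.torsion

/-- The reflection carries the Laplacian at the corner `i` to the Laplacian at the corner
`k - i`. -/
theorem reflect_corner (h : IsRotorHarmonic a p q o) (k i : Fin 3) :
    3 • a (k - i) - (∑ j, a j - o - q (k + 1 - i)) - (∑ j, a j - o - q (k + 1 - (i - 1))) -
      (2 • ∑ j, a j - 4 • o - p (k + 1 - i)) =
    3 • a (k - i) - p (k - i) - p (k - i - 1) - q (k - i) := by
  have h1 : k + 1 - i = k - i + 1 := by abel
  have h2 : k + 1 - (i - 1) = k - i - 1 := by decide +revert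
  have hP := sum_eq_add_add p (k - i)
  have hQ := sum_eq_add_add q (k - i)
  rw [h1, h2]
  linear_combination (norm := module) h.torsion - (4 : ℤ) • h.three_nsmul_center -
    h.three_nsmul_sum_inner - hP - hQ

end IsRotorHarmonic

variable {α β : Type*} {S : Graph α β}

theorem isRotorHarmonic_cls (hV : V(S).Finite) (hE : E(S).Finite) (g : Fin 3 → V(S)) :
    IsRotorHarmonic (fun i => cls (supergraph S g) (.inr (g i)))
      (fun i => cls (supergraph S g) (.inl (.side i)))
      (fun i => cls (supergraph S g) (.inl (.inner i))) (cls (supergraph S g) (.inl .center)) where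
  side i := (lap_side hV hE _ i).symm.trans
    (lap_cls (finite_supergraph hV) (mem_supergraph_inl.2 (by simp)))
  inner i := (lap_inner hV hE _ i).symm.trans
    (lap_cls (finite_supergraph hV) (mem_supergraph_inl.2 (by simp)))
  center := (lap_center hV hE _).symm.trans
    (lap_cls (finite_supergraph hV) (mem_supergraph_inl.2 (by simp)))

/-- A homomorphism between the Picard groups of two supergraphs of `S` which fixes the classes of
the vertices of `S` and acts on the rotor by the reflection of `IsRotorHarmonic.reflect`. -/
structure IsReflectionHom (k : Fin 3) (g h : Fin 3 → V(S))
    (F : Pic (supergraph S g) →+ Pic (supergraph S h)) : Prop where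
  inr : ∀ s ∈ V(S), F (cls _ (.inr s)) = cls _ (.inr s)
  side (i : Fin 3) : F (cls _ (.inl (.side i))) =
    ∑ j, cls _ (.inr (h j : α)) - cls _ (.inl .center) - cls _ (.inl (.inner (k + 1 - i)))
  inner (i : Fin 3) : F (cls _ (.inl (.inner i))) =
    2 • ∑ j, cls _ (.inr (h j : α)) - 4 • cls _ (.inl .center) - cls _ (.inl (.side (k + 1 - i)))
  center : F (cls _ (.inl .center)) = 4 • ∑ j, cls _ (.inr (h j : α)) - 11 • cls _ (.inl .center)

theorem exists_isReflectionHom (hV : V(S).Finite) (hE : E(S).Finite) {k : Fin 3}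
    {g h : Fin 3 → V(S)} (hgh : ∀ i, h (k - i) = g i) : ∃ F, IsReflectionHom k g h F := by
  classical
  have hharm := isRotorHarmonic_cls hV hE h
  have hrefl := hharm.reflect k
  set x := cls (supergraph S h)
  set z : RotorVertex ⊕ α → Pic (supergraph S h) :=
    glue (fun i => ∑ j, x (.inr (h j)) - x (.inl .center) - x (.inl (.inner (k + 1 - i))))
      (fun i => 2 • ∑ j, x (.inr (h j)) - 4 • x (.inl .center) - x (.inl (.side (k + 1 - i))))
      (4 • ∑ j, x (.inr (h j)) - 11 • x (.inl .center)) (x ∘ .inr)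
  obtain ⟨F, hF⟩ := exists_pic_lift (G := supergraph S g) (finite_supergraph hV) z (by
    rintro (r | s) hv
    · rcases r with i | i | i | _
      · exact absurd rfl (mem_supergraph_inl.1 hv i)
      · rw [lap_side hV hE, ← hgh, ← hgh]
        exact hrefl.side i
      · rw [lap_inner hV hE, ← hgh]
        exact hrefl.inner i
      · rw [lap_center hV hE]
        exact hrefl.center
    · have hs : lap (supergraph S h) x (.inr s) = 0 := lap_cls (finite_supergraph hV)
        (mem_supergraph_inr.2 (mem_supergraph_inr.1 hv))
      rw [lap_inr hV hE] at hs ⊢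
      refine Eq.trans ?_ hs
      refine congrArg _ ((Finset.sum_congr rfl fun i _ => ?_).trans
        (Equiv.sum_comp (Equiv.subLeft k) _))
      rw [← hgh]
      exact if_congr Iff.rfl (hharm.reflect_corner k i) rfl)
  refine ⟨F, fun s hs => hF _ (mem_supergraph_inr.2 hs), fun i => hF _ ?_, fun i => hF _ ?_,
    hF _ ?_⟩ <;> exact mem_supergraph_inl.2 (by simp)

theorem IsReflectionHom.picDeg_map {k : Fin 3} {g h : Fin 3 → V(S)}
    {F : Pic (supergraph S g) →+ Pic (supergraph S h)} (hF : IsReflectionHom k g h F)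
    {v : RotorVertex ⊕ α} (hv : v ∈ V(supergraph S g)) :
    picDeg (supergraph S h) (F (cls (supergraph S g) v)) = 1 := by
  have hinr {s : α} (hs : s ∈ V(S)) : picDeg _ (cls (supergraph S h) (.inr s)) = 1 :=
    picDeg_cls (mem_supergraph_inr.2 hs)
  have hinl {r : RotorVertex} (hr : ∀ i, r ≠ .corner i) :
      picDeg _ (cls (supergraph S h) (.inl r)) = 1 := picDeg_cls (mem_supergraph_inl.2 hr)
  rcases v with (i | i | i | _) | s
  · exact absurd rfl (mem_supergraph_inl.1 hv i)
  · simp [hF.side, hinr, hinl]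
  · simp [hF.inner, hinr, hinl]
  · simp [hF.center, hinr, hinl]
  · rw [hF.inr s (mem_supergraph_inr.1 hv), hinr (mem_supergraph_inr.1 hv)]

/-- Two reflections in opposite directions are inverse to each other: on each generator the
composite differs from the identity by a multiple of `15 o - 5 (a 0 + a 1 + a 2)`. -/
theorem IsReflectionHom.map_map (hV : V(S).Finite) (hE : E(S).Finite) {k : Fin 3}
    {g h : Fin 3 → V(S)} (hgh : ∀ i, h (k - i) = g i)
    {F : Pic (supergraph S g) →+ Pic (supergraph S h)} (hF : IsReflectionHom k g h F)
    {F' : Pic (supergraph S h) →+ Pic (supergraph S g)} (hF' : IsReflectionHom k h g F')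
    {v : RotorVertex ⊕ α} (hv : v ∈ V(supergraph S g)) :
    F' (F (cls (supergraph S g) v)) = cls (supergraph S g) v := by
  have hsum : ∑ j, F' (cls _ (.inr (h j : α))) = ∑ j, cls (supergraph S g) (.inr (g j : α)) := by
    rw [← Equiv.sum_comp (Equiv.subLeft k)]
    exact Finset.sum_congr rfl fun j _ => by rw [Equiv.subLeft_apply, hgh, hF'.inr _ (g j).2]
  have htors := (isRotorHarmonic_cls hV hE g).torsion
  rcases v with (i | i | i | _) | s
  · exact absurd rfl (mem_supergraph_inl.1 hv i)
  · rw [hF.side, map_sub, map_sub, map_sum, hsum, hF'.center, hF'.inner, sub_sub_cancel]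
    linear_combination (norm := module) htors
  · rw [hF.inner, map_sub, map_sub, map_nsmul, map_nsmul, map_sum, hsum, hF'.center, hF'.side,
      sub_sub_cancel]
    linear_combination (norm := module) (3 : ℤ) • htors
  · rw [hF.center, map_sub, map_nsmul, map_nsmul, map_sum, hsum, hF'.center]
    linear_combination (norm := module) (8 : ℤ) • htors
  · rw [hF.inr s (mem_supergraph_inr.1 hv), hF'.inr s (mem_supergraph_inr.1 hv)]

theorem nonempty_jac_equiv_reflection (hV : V(S).Finite) (hE : E(S).Finite) {k : Fin 3}
    {g h : Fin 3 → V(S)} (hgh : ∀ i, h (k - i) = g i) :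
    Nonempty (Jac (supergraph S g) ≃+ Jac (supergraph S h)) := by
  have hhg (i : Fin 3) : g (k - i) = h i := by rw [← hgh, sub_sub_cancel]
  obtain ⟨F, hF⟩ := exists_isReflectionHom hV hE hgh
  obtain ⟨F', hF'⟩ := exists_isReflectionHom hV hE hhg
  exact nonempty_jac_equiv F F' (fun v => hF.picDeg_map) (fun v => hF.map_map hV hE hgh hF')
    (fun v => hF'.map_map hV hE hhg hF)

end Reflection

end TutteRotor

theorem theorem4 {α β : Type*} (S : Graph α β)
    (hV : V(S).Finite) (hE : E(S).Finite) (hloop : S.Loopless)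
    (hconn : TutteRotor.IsConnected S) (hplanar : TutteRotor.IsPlanar S)
    (g : Fin 3 → V(S)) (σ : Equiv.Perm (Fin 3))
    (hG : TutteRotor.IsPlanar (TutteRotor.supergraph S g))
    (hH : TutteRotor.IsPlanar (TutteRotor.supergraph S (g ∘ σ))) :
    Nonempty (TutteRotor.Jac (TutteRotor.supergraph S g) ≃+
      TutteRotor.Jac (TutteRotor.supergraph S (g ∘ σ))) := by
  clear hG hH
  induction σ using Equiv.Perm.swap_induction_on generalizing g with
  | one => exact ⟨AddEquiv.refl _⟩
  | swap_mul τ i j hij ih =>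
    -- the transposition of `i` and `j` is `l ↦ i + j - l`, as the three indices add up to `0`
    obtain ⟨e⟩ := TutteRotor.nonempty_jac_equiv_reflection hV hE (k := i + j) (g := g)
      (h := g ∘ Equiv.swap i j) fun l => congrArg g (by decide +revert)
    obtain ⟨e'⟩ := ih (g ∘ Equiv.swap i j)
    exact ⟨e.trans e'⟩
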